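/- Fix a sample space $\Omega$ (a measurable space) and a real-valued random variable $X$ on it (the single observation) such that every Borel probability measure on $\mathbb R$ is the law of $X$ under some probability measure on $\Omega$. A hypothesis is a set $H$ of probability measures on $\Omega$. A random variable $P$ is a p-variable for $H$ if $Q(P\le\alpha)\le\alpha$ for all $\alpha\in(0,1)$ and all $Q\in H$; it is precise if moreover $\sup_{Q\in H}Q(P\le\alpha)=\alpha$ for every $\alpha\in(0,1)$. A $[0,\infty]$-valued random variable $E$ is an e-variable for $H$ if $\mathbb E^Q[E]\le 1$ for all $Q\in H$; it is precise if moreover $\sup_{Q\in H}\mathbb E^Q[E]=1$. A distribution on $\mathbb R$ is unimodal if there is $x\in\mathbb R$ such that the distribution has an increasing density on $(-\infty,x)$ and a decreasing density on $(x,\infty)$ (both in the non-strict sense), with possibly a point mass at $x$. For $\mu\in\mathbb R$ and $\sigma>0$ let $H_{\rm U}(\mu,\sigma)$ be the set of all probability measures $Q$ on $\Omega$ under which $X$ has a finite second moment, $\mathbb E^Q[X]\le\mu$, $\mathrm{Var}^Q(X)\le\sigma^2$, and the distribution of $X$ is unimodal. With $x_+=\max\{x,0\}$, put $$P_0=\left(1+\frac{(X-\mu)_+^2}{\sigma^2}\right)^{-1},\qquad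 E_0=\frac{(X-\mu)_+^2}{\sigma^2}.$$ Theorem. For all $\mu\in\mathbb R$ and $\sigma>0$, a precise p-variable for $H_{\rm U}(\mu,\sigma)$ is $$P=\max\left\{\frac49P_0,\ \frac{4P_0-1}{3}\right\},$$ and a precise e-variable for $H_{\rm U}(\mu,\sigma)$ is $E=E_0$. -/

import Mathlib

open MeasureTheory ProbabilityTheory
open scoped ENNReal NNReal

/-- A Borel measure `ν` on `ℝ` is unimodal if, for some mode `m`, it is the sum of an absolutely
continuous part, whose density is increasing on `(-∞, m)` and decreasing on `(m, ∞)`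
(in the non-strict sense), and a possible point mass `c` at `m`. -/
def IsUnimodal (ν : Measure ℝ) : Prop :=
  ∃ (m : ℝ) (f : ℝ → ℝ≥0) (c : ℝ≥0),
    MonotoneOn f (Set.Iio m) ∧ AntitoneOn f (Set.Ioi m) ∧
      ν = (volume.withDensity fun x => (f x : ℝ≥0∞)) + (c : ℝ≥0∞) • Measure.dirac m

section Testing

variable {Ω : Type*} [MeasurableSpace Ω]

/-- A hypothesis is a set `H` of probability measures on the sample space. A random variable `P`
is a p-variable for `H` if `Q (P ≤ α) ≤ α` for all `α ∈ (0,1)` and all `Q ∈ H`. -/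
def IsPVariable (H : Set (ProbabilityMeasure Ω)) (P : Ω → ℝ) : Prop :=
  Measurable P ∧
    ∀ Q ∈ H, ∀ α ∈ Set.Ioo (0 : ℝ) 1, (Q : Measure Ω) {ω | P ω ≤ α} ≤ ENNReal.ofReal α

/-- A p-variable `P` for `H` is precise if `sup_{Q ∈ H} Q (P ≤ α) = α` for each `α ∈ (0,1)`. -/
def IsPrecisePVariable (H : Set (ProbabilityMeasure Ω)) (P : Ω → ℝ) : Prop :=
  IsPVariable H P ∧
    ∀ α ∈ Set.Ioo (0 : ℝ) 1,
      (⨆ Q ∈ H, (Q : Measure Ω) {ω | P ω ≤ α}) = ENNReal.ofReal α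

/-- A `[0,∞]`-valued random variable `E` is an e-variable for `H` if `𝔼^Q[E] ≤ 1` for all
`Q ∈ H`. -/
def IsEVariable (H : Set (ProbabilityMeasure Ω)) (E : Ω → ℝ≥0∞) : Prop :=
  Measurable E ∧ ∀ Q ∈ H, (∫⁻ ω, E ω ∂(Q : Measure Ω)) ≤ 1

/-- An e-variable `E` for `H` is precise if `sup_{Q ∈ H} 𝔼^Q[E] = 1`. -/
def IsPreciseEVariable (H : Set (ProbabilityMeasure Ω)) (E : Ω → ℝ≥0∞) : Prop :=
  IsEVariable H E ∧ (⨆ Q ∈ H, ∫⁻ ω, E ω ∂(Q : Measure Ω)) = 1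

/-- The probability measures under which `X` has a finite second moment, mean at most `μ` and
variance at most `σ²`. -/
def hypMeanVar (X : Ω → ℝ) (μ σ : ℝ) : Set (ProbabilityMeasure Ω) :=
  {Q | MemLp X 2 (Q : Measure Ω) ∧ (∫ ω, X ω ∂(Q : Measure Ω)) ≤ μ ∧
    variance X (Q : Measure Ω) ≤ σ ^ 2}

/-- The members of `hypMeanVar X μ σ` under which the law of `X` is unimodal. -/
def hypUnimodal (X : Ω → ℝ) (μ σ : ℝ) : Set (ProbabilityMeasure Ω) :=
  {Q | Q ∈ hypMeanVar X μ σ ∧ IsUnimodal ((Q : Measure Ω).map X)}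

/-- The baseline e-value `E₀ = (X - μ)₊² / σ²`. -/
noncomputable def baseE (X : Ω → ℝ) (μ σ : ℝ) (ω : Ω) : ℝ :=
  (max (X ω - μ) 0) ^ 2 / σ ^ 2

/-- The baseline p-value `P₀ = (1 + (X - μ)₊² / σ²)⁻¹`. -/
noncomputable def baseP (X : Ω → ℝ) (μ σ : ℝ) (ω : Ω) : ℝ :=
  (1 + (max (X ω - μ) 0) ^ 2 / σ ^ 2)⁻¹

/-- The sample space carries every distribution of the observation: each Borel probability measure
on `ℝ` is the law of `X` under some probability measure on `Ω` (as for `Ω = ℝ`, `X = id`, or for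
a coordinate projection). -/
def CarriesAllLaws (X : Ω → ℝ) : Prop :=
  ∀ ν : ProbabilityMeasure ℝ, ∃ Q : ProbabilityMeasure Ω,
    (Q : Measure Ω).map X = (ν : Measure ℝ)

end Testing

/-! A unimodal law with mode `m` is a mixture of the point mass at `m` and uniform laws on intervals
ending at `m`. By layer cake, an integral inequality thus need only be checked at `m` and on such
intervals (`lintegral_le_of_unimodal`).

For the tail bound, `exists_quadratic_certificate` supplies `l ∈ [0, 1]`, depending on the rescaled
mode, such that `l/3 + 1_{x ≥ 1}` lies on average below `4/9 * (1 + 2l) * x²`. With Cantelli's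
centre and scale, the rescaled second moment is at most `q = (1 + z²)⁻¹`. The tail is then at most
`(1 - l) * (4q/9) + l * (4q - 1)/3`, hence at most the larger of the two terms. Equality in the
certificate points to the extremal laws: an atom at the mode plus a uniform part, with the mode at
the left end for the first term and at the right end for the second.

For `E₀`, the bound is `E₀ ≤ (X - M)²/σ²` with `M ≤ μ` the mean. The left-mode laws with `z → ∞`
make it sharp, since they barely reach below `μ`. -/

/-! ### Reduction of unimodal laws to intervals ending at the mode -/

/-- If `μ₁ (m, y] ≤ μ₂ (m, y]` for all `y`, the same holds for every initial segment of
`(m, ∞)`. -/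
theorem measure_le_of_initial_segment {μ₁ μ₂ : Measure ℝ} [NullSingletonClass μ₂] {m : ℝ}
    (h : ∀ y, m ≤ y → μ₁ (Set.Ioc m y) ≤ μ₂ (Set.Ioc m y)) {s : Set ℝ}
    (hs : s ⊆ Set.Ioi m) (hs' : ∀ x ∈ s, ∀ y ∈ Set.Ioc m x, y ∈ s) : μ₁ s ≤ μ₂ s := by
  rcases s.eq_empty_or_nonempty with rfl | hne
  · simp
  by_cases hb : BddAbove s
  · set b := sSup s with hbdef
    have h1 : s ⊆ Set.Ioc m b := fun x hx => ⟨hs hx, le_csSup hb hx⟩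
    have h2 : Set.Ioo m b ⊆ s := by
      intro x hx
      obtain ⟨y, hy, hxy⟩ := exists_lt_of_lt_csSup hne hx.2
      exact hs' y hy x ⟨hx.1, hxy.le⟩
    have hmb : m ≤ b := by
      obtain ⟨x, hx⟩ := hne
      exact ((h1 hx).1.trans_le (h1 hx).2).le
    calc μ₁ s ≤ μ₁ (Set.Ioc m b) := measure_mono h1
      _ ≤ μ₂ (Set.Ioc m b) := h b hmb
      _ = μ₂ (Set.Ioo m b) := measure_congr Ioo_ae_eq_Ioc.symm
      _ ≤ μ₂ s := measure_mono h2
  · have hsE : s = ⋃ n : ℕ, Set.Ioc m (m + n) := by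
      ext x
      simp only [Set.mem_iUnion]
      constructor
      · intro hx
        obtain ⟨n, hn⟩ := exists_nat_ge (x - m)
        exact ⟨n, hs hx, by linarith⟩
      · rintro ⟨n, hn⟩
        rw [not_bddAbove_iff] at hb
        obtain ⟨y, hy, hxy⟩ := hb x
        exact hs' y hy x ⟨hn.1, hxy.le⟩
    have hmono : Monotone fun n : ℕ => Set.Ioc m (m + n) := by
      intro a b hab
      have : (a : ℝ) ≤ b := by exact_mod_cast hab
      exact Set.Ioc_subset_Ioc_right (by linarith)
    rw [hsE]
    refine le_of_tendsto_of_tendsto' (tendsto_measure_iUnion_atTop hmono)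
      (tendsto_measure_iUnion_atTop hmono) fun n => h _ (by simp)

/-- If `μ₁ (y, m] ≤ μ₂ (y, m]` for all `y`, the same holds for every final segment of
`(-∞, m)`. -/
theorem measure_le_of_final_segment {μ₁ μ₂ : Measure ℝ} [NullSingletonClass μ₁] [NullSingletonClass μ₂] {m : ℝ}
    (h : ∀ y, y ≤ m → μ₁ (Set.Ioc y m) ≤ μ₂ (Set.Ioc y m)) {s : Set ℝ}
    (hs : s ⊆ Set.Iio m) (hs' : ∀ x ∈ s, ∀ y ∈ Set.Ico x m, y ∈ s) : μ₁ s ≤ μ₂ s := by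
  -- Reflect to the previous lemma; the open and closed ends swap, which is harmless because
  -- singletons are null.
  have key : ∀ (μ : Measure ℝ) (t : Set ℝ), μ.map Neg.neg t = μ (-t) := fun μ t =>
    (MeasurableEquiv.neg ℝ).map_apply t
  have hna : NullSingletonClass (μ₂.map Neg.neg) := ⟨fun x => by rw [key]; simp⟩
  have := measure_le_of_initial_segment (μ₁ := μ₁.map Neg.neg) (μ₂ := μ₂.map Neg.neg) (m := -m)
    (s := -s) ?_ ?_ ?_
  · simpa [key] using this
  · intro y hy
    rw [key, key, Set.neg_Ioc, neg_neg, measure_congr (Ico_ae_eq_Ioc (μ := μ₁)),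
      measure_congr (Ico_ae_eq_Ioc (μ := μ₂))]
    exact h _ (by linarith)
  · intro x hx
    have := hs hx
    simp only [Set.mem_Iio, Set.mem_Ioi] at this ⊢
    linarith
  · intro x hx y hy
    exact hs' _ hx _ ⟨by linarith [hy.2], by linarith [hy.1]⟩

/-- Layer-cake comparison of the integrals of a function against two measures. -/
theorem setLIntegral_le_of_superlevel {μ₁ μ₂ : Measure ℝ} {s : Set ℝ} {f : ℝ → ℝ≥0}
    (hs : MeasurableSet s) (hf₁ : AEMeasurable f (μ₁.restrict s))
    (hf₂ : AEMeasurable f (μ₂.restrict s))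
    (h : ∀ t : ℝ, μ₁ ({x | t < f x} ∩ s) ≤ μ₂ ({x | t < f x} ∩ s)) :
    ∫⁻ x in s, f x ∂μ₁ ≤ ∫⁻ x in s, f x ∂μ₂ := by
  have key : ∀ μ : Measure ℝ, AEMeasurable f (μ.restrict s) →
      ∫⁻ x in s, f x ∂μ = ∫⁻ t in Set.Ioi (0 : ℝ), μ ({x | t < f x} ∩ s) := by
    intro μ hf
    have := lintegral_eq_lintegral_meas_lt (μ.restrict s) (f := fun x => (f x : ℝ))
      (Filter.Eventually.of_forall fun x => (f x).2) (by fun_prop)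
    simp only [ENNReal.ofReal_coe_nnreal] at this
    rw [this]
    refine lintegral_congr fun t => ?_
    rw [Measure.restrict_apply' hs]
  rw [key _ hf₁, key _ hf₂]
  exact lintegral_mono fun t => h t

/-- A density that increases up to `m` and decreases afterwards has a smaller integral against
`μ₁` than against `μ₂` as soon as this is so for the indicators of intervals ending at `m`. -/
theorem lintegral_le_of_unimodal_density {μ₁ μ₂ : Measure ℝ} [NullSingletonClass μ₁] [NullSingletonClass μ₂] {m : ℝ}
    {f : ℝ → ℝ≥0} (hl : MonotoneOn f (Set.Iio m)) (hr : AntitoneOn f (Set.Ioi m))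
    (h₁ : ∀ y, m ≤ y → μ₁ (Set.Ioc m y) ≤ μ₂ (Set.Ioc m y))
    (h₂ : ∀ y, y ≤ m → μ₁ (Set.Ioc y m) ≤ μ₂ (Set.Ioc y m)) :
    ∫⁻ x, f x ∂μ₁ ≤ ∫⁻ x, f x ∂μ₂ := by
  have split : ∀ (μ : Measure ℝ) [NullSingletonClass μ], ∫⁻ x, f x ∂μ =
      ∫⁻ x in Set.Iio m, f x ∂μ + ∫⁻ x in Set.Ioi m, f x ∂μ := by
    intro μ _
    rw [← lintegral_add_compl _ (measurableSet_Iio (a := m)), Set.compl_Iio,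
      setLIntegral_congr Ioi_ae_eq_Ici]
  rw [split μ₁, split μ₂]
  refine add_le_add (setLIntegral_le_of_superlevel measurableSet_Iio
    (aemeasurable_restrict_of_monotoneOn measurableSet_Iio hl)
    (aemeasurable_restrict_of_monotoneOn measurableSet_Iio hl) fun t => ?_)
    (setLIntegral_le_of_superlevel measurableSet_Ioi
    (aemeasurable_restrict_of_antitoneOn measurableSet_Ioi hr)
    (aemeasurable_restrict_of_antitoneOn measurableSet_Ioi hr) fun t => ?_)
  · refine measure_le_of_final_segment h₂ Set.inter_subset_right ?_
    rintro x ⟨hx, hxm⟩ y hy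
    exact ⟨lt_of_lt_of_le (b := (f x : ℝ)) hx (NNReal.coe_le_coe.2 (hl hxm hy.2 hy.1)), hy.2⟩
  · refine measure_le_of_initial_segment h₁ Set.inter_subset_right ?_
    rintro x ⟨hx, hxm⟩ y hy
    exact ⟨lt_of_lt_of_le (b := (f x : ℝ)) hx (NNReal.coe_le_coe.2 (hr hy.1 hxm hy.2)), hy.1⟩

theorem aemeasurable_of_unimodal {m : ℝ} {f : ℝ → ℝ≥0} (hl : MonotoneOn f (Set.Iio m))
    (hr : AntitoneOn f (Set.Ioi m)) : AEMeasurable f := by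
  have h1 : AEMeasurable f (volume.restrict (Set.Iio m)) :=
    aemeasurable_restrict_of_monotoneOn measurableSet_Iio hl
  have h2 : AEMeasurable f (volume.restrict (Set.Ioi m)) :=
    aemeasurable_restrict_of_antitoneOn measurableSet_Ioi hr
  have h3 : AEMeasurable f (volume.restrict (Set.Ici m)) := by
    rwa [← Measure.restrict_congr_set Ioi_ae_eq_Ici]
  have := aemeasurable_union_iff.2 ⟨h1, h3⟩
  rwa [Set.Iio_union_Ici, Measure.restrict_univ] at this

/-- Integral inequalities for a unimodal law reduce to intervals having the mode as an endpoint,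
and to the mode itself. -/
theorem lintegral_le_of_unimodal {m : ℝ} {f : ℝ → ℝ≥0} {c : ℝ≥0}
    (hl : MonotoneOn f (Set.Iio m)) (hr : AntitoneOn f (Set.Ioi m)) {g₁ g₂ : ℝ → ℝ≥0∞}
    (hg₁ : Measurable g₁) (hg₂ : Measurable g₂)
    (h₀ : g₁ m ≤ g₂ m)
    (h₁ : ∀ y, m ≤ y → ∫⁻ x in Set.Ioc m y, g₁ x ≤ ∫⁻ x in Set.Ioc m y, g₂ x)
    (h₂ : ∀ y, y ≤ m → ∫⁻ x in Set.Ioc y m, g₁ x ≤ ∫⁻ x in Set.Ioc y m, g₂ x) :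
    ∫⁻ x, g₁ x ∂((volume.withDensity fun x => (f x : ℝ≥0∞)) + (c : ℝ≥0∞) • Measure.dirac m) ≤
      ∫⁻ x, g₂ x ∂((volume.withDensity fun x => (f x : ℝ≥0∞)) +
        (c : ℝ≥0∞) • Measure.dirac m) := by
  have hf : AEMeasurable (fun x => (f x : ℝ≥0∞)) :=
    (aemeasurable_of_unimodal hl hr).coe_nnreal_ennreal
  -- Exchange density and integrand: `f` is integrated against the measure with density `g`, so that
  -- `h₁` and `h₂` compare measures of intervals.
  have key : ∀ g : ℝ → ℝ≥0∞, Measurable g →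
      ∫⁻ x, g x ∂(volume.withDensity fun x => (f x : ℝ≥0∞)) =
        ∫⁻ x, f x ∂(volume.withDensity g) := by
    intro g hg
    rw [lintegral_withDensity_eq_lintegral_mul₀ hf hg.aemeasurable,
      lintegral_withDensity_eq_lintegral_mul₀ hg.aemeasurable hf, mul_comm]
  rw [lintegral_add_measure, lintegral_add_measure, lintegral_smul_measure,
    lintegral_smul_measure, lintegral_dirac' _ hg₁, lintegral_dirac' _ hg₂, key _ hg₁, key _ hg₂]
  refine add_le_add (lintegral_le_of_unimodal_density hl hr ?_ ?_) ?_
  · intro y hy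
    rw [withDensity_apply _ measurableSet_Ioc, withDensity_apply _ measurableSet_Ioc]
    exact h₁ y hy
  · intro y hy
    rw [withDensity_apply _ measurableSet_Ioc, withDensity_apply _ measurableSet_Ioc]
    exact h₂ y hy
  · gcongr

/-! ### The quadratic certificate and the tail inequality -/

/-- The quadratic dominating the indicator of `[1, ∞)` on average over every interval that has
`m` as an endpoint. -/
theorem exists_quadratic_certificate (m : ℝ) :
    ∃ l : ℝ, 0 ≤ l ∧ l ≤ 1 ∧
      l / 3 + (if 1 ≤ m then 1 else 0) ≤ 4 / 9 * (1 + 2 * l) * m ^ 2 ∧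
      (∀ y, m ≤ y → l / 3 * (y - m) + (max y 1 - max m 1) ≤
        4 / 9 * (1 + 2 * l) * ((y ^ 3 - m ^ 3) / 3)) ∧
      (∀ y, y ≤ m → l / 3 * (m - y) + (max m 1 - max y 1) ≤
        4 / 9 * (1 + 2 * l) * ((m ^ 3 - y ^ 3) / 3)) := by
  rcases le_or_gt 1 m with hm | hm
  · refine ⟨1, by norm_num, le_rfl, ?_, ?_, ?_⟩
    · rw [if_pos hm]; nlinarith
    · intro y hy
      rw [max_eq_left hm, max_eq_left (hm.trans hy)]
      have h1 : 0 ≤ (y - m) * (y ^ 2 + y * m + m ^ 2 - 3) :=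
        mul_nonneg (by linarith) (by nlinarith)
      nlinarith
    · intro y hy
      rw [max_eq_left hm]
      have h1 : 0 ≤ (m - 1) ^ 2 * (m + 2) := mul_nonneg (sq_nonneg _) (by linarith)
      rcases le_or_gt 1 y with h | h
      · rw [max_eq_left h]
        have h1 : 0 ≤ (m - y) * (y ^ 2 + y * m + m ^ 2 - 3) :=
          mul_nonneg (by linarith) (by nlinarith)
        nlinarith
      · rw [max_eq_right h.le]
        -- Equality at `m = 1`, `y = -1/2`: the uniform part of the right-mode extremal law.
        have h2 : 0 ≤ (1 - y) * (2 * y + 1) ^ 2 := mul_nonneg (by linarith) (sq_nonneg _)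
        nlinarith
  rcases le_or_gt m 0 with hm0 | hm0
  · refine ⟨0, le_rfl, by norm_num, ?_, ?_, ?_⟩
    · rw [if_neg hm.not_ge]; nlinarith
    · intro y hy
      rw [max_eq_right hm.le]
      rcases le_or_gt y 1 with h | h
      · rw [max_eq_right h]
        nlinarith [mul_nonneg (sub_nonneg.2 hy)
          (show 0 ≤ y ^ 2 + y * m + m ^ 2 by nlinarith [sq_nonneg (y + m)])]
      · rw [max_eq_left h.le]
        -- Equality at `m = 0`, `y = 3/2`: the uniform part of the left-mode extremal law.
        have h2 : 0 ≤ (2 * y - 3) ^ 2 * (y + 3) := mul_nonneg (sq_nonneg _) (by linarith)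
        have h3 : m ^ 3 ≤ 0 := by nlinarith [mul_nonneg (sq_nonneg m) (neg_nonneg.2 hm0)]
        nlinarith
    · intro y hy
      rw [max_eq_right hm.le, max_eq_right (by linarith)]
      nlinarith [mul_nonneg (sub_nonneg.2 hy)
        (show 0 ≤ y ^ 2 + y * m + m ^ 2 by nlinarith [sq_nonneg (y + m)])]
  have hm2 : m ^ 2 < 1 := by nlinarith
  have hD : 0 < 3 - 2 * m ^ 2 := by linarith
  have hA : 4 / 9 * (1 + 2 * (m ^ 2 / (3 - 2 * m ^ 2))) = 4 / 3 / (3 - 2 * m ^ 2) := by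
    field_simp; ring
  -- The largest `l` allowed by the intervals `(y, m]`; the worst of these is `y = -m/2`.
  refine ⟨m ^ 2 / (3 - 2 * m ^ 2), by positivity, ?_, ?_, ?_, ?_⟩
  · rw [div_le_one hD]; linarith
  · rw [hA, if_neg hm.not_ge, ← sub_nonneg]
    have : 4 / 3 / (3 - 2 * m ^ 2) * m ^ 2 - (m ^ 2 / (3 - 2 * m ^ 2) / 3 + 0) =
      m ^ 2 / (3 - 2 * m ^ 2) := by field_simp; ring
    rw [this]; positivity
  · intro y hy
    rw [hA, max_eq_right hm.le, ← sub_nonneg]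
    have : 4 / 3 / (3 - 2 * m ^ 2) * ((y ^ 3 - m ^ 3) / 3) -
        (m ^ 2 / (3 - 2 * m ^ 2) / 3 * (y - m) + (max y 1 - 1)) =
      (4 * y ^ 3 - 3 * m ^ 2 * y - m ^ 3 - 9 * (3 - 2 * m ^ 2) * (max y 1 - 1)) /
        (9 * (3 - 2 * m ^ 2)) := by field_simp; ring
    rw [this]
    refine div_nonneg ?_ (by positivity)
    rcases le_or_gt y 1 with h | h
    · rw [max_eq_right h]
      nlinarith [mul_nonneg (sub_nonneg.2 hy) (sq_nonneg (2 * y + m))]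
    · rw [max_eq_left h.le]
      -- The numerator is `4y³ - 3s²y + (27 - 18m² - m³)`, minimal over `y ≥ 0` at `y = s/2`, where
      -- the first two terms give `-s³`.
      set s := Real.sqrt (9 - 5 * m ^ 2) with hs
      have hs0 : 0 ≤ s := Real.sqrt_nonneg _
      have hs2 : s ^ 2 = 9 - 5 * m ^ 2 := Real.sq_sqrt (by linarith)
      have hcube : s ^ 3 ≤ 27 - 18 * m ^ 2 - m ^ 3 := by
        have h0 : 0 ≤ 27 - 18 * m ^ 2 - m ^ 3 := by nlinarith
        refine le_of_sq_le_sq ?_ h0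
        have e : (s ^ 3) ^ 2 = (9 - 5 * m ^ 2) ^ 3 := by rw [← hs2]; ring
        rw [e]
        have : 0 ≤ 9 * m ^ 2 * (1 - m) * (7 * m + 9) * (3 - 2 * m ^ 2) := by
          have : 0 < 1 - m := by linarith
          positivity
        linarith
      have h2 : 0 ≤ (2 * y - s) ^ 2 * (y + s) := by positivity
      have e2 : (2 * y - s) ^ 2 * (y + s) = 4 * y ^ 3 - 3 * s ^ 2 * y + s ^ 3 := by ring
      rw [e2, hs2] at h2
      linarith
  · intro y hy
    rw [hA, max_eq_right hm.le, max_eq_right (by linarith), ← sub_nonneg]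
    have : 4 / 3 / (3 - 2 * m ^ 2) * ((m ^ 3 - y ^ 3) / 3) -
        (m ^ 2 / (3 - 2 * m ^ 2) / 3 * (m - y) + (1 - 1)) =
      (m - y) * (2 * y + m) ^ 2 / (9 * (3 - 2 * m ^ 2)) := by field_simp; ring
    rw [this]
    have : 0 ≤ m - y := by linarith
    positivity

theorem setLIntegral_Ioc_const_add_indicator {B t a b : ℝ} (hB : 0 ≤ B) (hab : a ≤ b) :
    ∫⁻ x in Set.Ioc a b, (ENNReal.ofReal B + (Set.Ici t).indicator 1 x) =
      ENNReal.ofReal (B * (b - a) + (max b t - max a t)) := by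
  rw [lintegral_add_left measurable_const, setLIntegral_const,
    lintegral_indicator_one measurableSet_Ici, Measure.restrict_apply measurableSet_Ici,
    Real.volume_Ioc, ← ENNReal.ofReal_mul hB, measure_congr
      (Ioi_ae_eq_Ici.symm.inter (Filter.EventuallyEq.refl _ (Set.Ioc a b))), Set.inter_comm,
    Set.Ioc_inter_Ioi,
    Real.volume_Ioc, ENNReal.ofReal_add (mul_nonneg hB (by linarith))
      (sub_nonneg.2 (max_le_max_right t hab))]
  congr 1
  rcases le_total t b with h | h
  · rw [max_eq_left h]
  · rw [max_eq_right h, max_eq_right (hab.trans h), sub_self,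
      ENNReal.ofReal_of_nonpos (by linarith), ENNReal.ofReal_zero]

theorem setLIntegral_Ioc_sq {A k a b : ℝ} (c : ℝ) (hA : 0 ≤ A) (hk : 0 < k) (hab : a ≤ b) :
    ∫⁻ x in Set.Ioc a b, ENNReal.ofReal (A * ((x - c) / k) ^ 2) =
      ENNReal.ofReal (k * (A * ((((b - c) / k) ^ 3 - ((a - c) / k) ^ 3) / 3))) := by
  have hcont : Continuous fun x : ℝ => A * ((x - c) / k) ^ 2 := by fun_prop
  rw [← ofReal_integral_eq_lintegral_ofReal
    (hcont.integrableOn_Ioc) (Filter.Eventually.of_forall fun x => by positivity),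
    ← intervalIntegral.integral_of_le hab]
  congr 1
  have hd : ∀ x ∈ Set.uIcc a b, HasDerivAt (fun x : ℝ => k * (A * (((x - c) / k) ^ 3 / 3)))
      (A * ((x - c) / k) ^ 2) x := by
    intro x _
    have h0 := ((((((hasDerivAt_id x).sub_const c).div_const k).pow 3).div_const 3).const_mul
      A).const_mul k
    refine h0.congr_deriv ?_
    have hk' : k * (1 / k) = 1 := by field_simp
    simp only [id]
    norm_num
    linear_combination A * ((x - c) / k) ^ 2 * hk'
  rw [intervalIntegral.integral_eq_sub_of_hasDerivAt hd (hcont.intervalIntegrable _ _)]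
  ring

/-- A one-sided Vysochanskij–Petunin inequality in dual form. -/
theorem IsUnimodal.exists_tail_le {ν : Measure ℝ} [IsProbabilityMeasure ν] (h : IsUnimodal ν)
    (c : ℝ) {k : ℝ} (hk : 0 < k) :
    ∃ l : ℝ, 0 ≤ l ∧ l ≤ 1 ∧ ENNReal.ofReal (l / 3) + ν (Set.Ici (c + k)) ≤
      ∫⁻ x, ENNReal.ofReal (4 / 9 * (1 + 2 * l) * ((x - c) / k) ^ 2) ∂ν := by
  obtain ⟨m, f, w, hl, hr, hν⟩ := h
  obtain ⟨l, hl0, hl1, h0, h1, h2⟩ := exists_quadratic_certificate ((m - c) / k)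
  refine ⟨l, hl0, hl1, ?_⟩
  have hA : 0 ≤ 4 / 9 * (1 + 2 * l) := by positivity
  have hmax : ∀ y : ℝ, max y (c + k) = c + k * max ((y - c) / k) 1 := by
    intro y
    rw [mul_max_of_nonneg _ _ hk.le, mul_div_cancel₀ _ hk.ne', mul_one, ← max_add_add_left]
    ring_nf
  have hdiv : ∀ x y : ℝ, y - x = k * ((y - c) / k - (x - c) / k) := by
    intro x y; field_simp; ring
  have := lintegral_le_of_unimodal (c := w) hl hr
    (g₁ := fun x => ENNReal.ofReal (l / 3) + (Set.Ici (c + k)).indicator 1 x)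
    (g₂ := fun x => ENNReal.ofReal (4 / 9 * (1 + 2 * l) * ((x - c) / k) ^ 2))
    ((measurable_one.indicator measurableSet_Ici).const_add _) (by fun_prop) ?_ ?_ ?_
  · rw [← hν] at this
    rwa [lintegral_add_left measurable_const, lintegral_const, measure_univ, mul_one,
      lintegral_indicator_one measurableSet_Ici] at this
  · have hiff : c + k ≤ m ↔ 1 ≤ (m - c) / k := by
      rw [le_div_iff₀ hk]; constructor <;> intro h <;> linarith
    by_cases hm : c + k ≤ m
    · rw [if_pos (hiff.1 hm)] at h0
      rw [Set.indicator_of_mem (Set.mem_Ici.2 hm), Pi.one_apply, ← ENNReal.ofReal_one,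
        ← ENNReal.ofReal_add (by positivity) zero_le_one]
      exact ENNReal.ofReal_le_ofReal h0
    · rw [if_neg fun h => hm (hiff.2 h)] at h0
      rw [Set.indicator_of_notMem (by simpa using hm), add_zero]
      exact ENNReal.ofReal_le_ofReal (by linarith)
  · intro y hy
    rw [setLIntegral_Ioc_const_add_indicator (by positivity) hy, setLIntegral_Ioc_sq c hA hk hy]
    refine ENNReal.ofReal_le_ofReal ?_
    rw [hmax, hmax, hdiv m y]
    have := mul_le_mul_of_nonneg_left (h1 ((y - c) / k) (by gcongr)) hk.le
    linarith
  · intro y hy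
    rw [setLIntegral_Ioc_const_add_indicator (by positivity) hy, setLIntegral_Ioc_sq c hA hk hy]
    refine ENNReal.ofReal_le_ofReal ?_
    rw [hmax, hmax, hdiv y m]
    have := mul_le_mul_of_nonneg_left (h2 ((y - c) / k) (by gcongr)) hk.le
    linarith

/-! ### Upper bounds over the hypothesis -/

section UpperBounds

variable {Ω : Type*} [MeasurableSpace Ω] {X : Ω → ℝ} {μ σ : ℝ} {Q : ProbabilityMeasure Ω}

theorem integral_sub_sq_eq (hQ : MemLp X 2 (Q : Measure Ω)) (c : ℝ) :
    ∫ ω, (X ω - c) ^ 2 ∂(Q : Measure Ω) =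
      variance X (Q : Measure Ω) + ((∫ ω, X ω ∂(Q : Measure Ω)) - c) ^ 2 := by
  have hX1 : Integrable X (Q : Measure Ω) := hQ.integrable one_le_two
  have hX2 : Integrable (fun ω => X ω ^ 2) (Q : Measure Ω) := hQ.integrable_sq
  have e : (fun ω => (X ω - c) ^ 2) = fun ω => X ω ^ 2 - 2 * c * X ω + c ^ 2 := by
    ext ω; ring
  rw [e, integral_add (f := fun ω => X ω ^ 2 - 2 * c * X ω) (hX2.sub (hX1.const_mul (2 * c)))
    (integrable_const _), integral_sub hX2 (hX1.const_mul _), integral_const_mul, variance_eq_sub hQ]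
  simp
  ring

theorem lintegral_mul_sub_sq_eq (hQ : MemLp X 2 (Q : Measure Ω)) {a : ℝ} (ha : 0 ≤ a) (c : ℝ) :
    ∫⁻ ω, ENNReal.ofReal (a * (X ω - c) ^ 2) ∂(Q : Measure Ω) =
      ENNReal.ofReal (a * (variance X (Q : Measure Ω) +
        ((∫ ω, X ω ∂(Q : Measure Ω)) - c) ^ 2)) := by
  rw [← ofReal_integral_eq_lintegral_ofReal (f := fun ω => a * (X ω - c) ^ 2)
    ((hQ.sub (memLp_const c)).integrable_sq.const_mul a)
    (Filter.Eventually.of_forall fun ω => by positivity), integral_const_mul,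
    integral_sub_sq_eq hQ]

theorem measure_tail_le_of_mem_hypUnimodal (hX : Measurable X) (hσ : 0 < σ)
    (hQ : Q ∈ hypUnimodal X μ σ) {z : ℝ} (hz : 0 < z) :
    (Q : Measure Ω) {ω | μ + σ * z ≤ X ω} ≤
      ENNReal.ofReal (max (4 / 9 * (1 + z ^ 2)⁻¹) ((4 * (1 + z ^ 2)⁻¹ - 1) / 3)) := by
  obtain ⟨⟨hL, hmean, hvar⟩, huni⟩ := hQ
  set M := ∫ ω, X ω ∂(Q : Measure Ω) with hM
  have : IsProbabilityMeasure ((Q : Measure Ω).map X) :=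
    Measure.isProbabilityMeasure_map hX.aemeasurable
  -- Cantelli's choice: the centre `M - σ/z` minimizes the bound on the second moment about the
  -- centre relative to `k²`, and `centre + k` is the threshold `M + σz`.
  set k := σ * (z + 1 / z) with hk
  have hk0 : 0 < k := by positivity
  obtain ⟨l, hl0, hl1, hl⟩ := huni.exists_tail_le (M - σ / z) hk0
  have hck : M - σ / z + k = M + σ * z := by rw [hk]; ring
  rw [hck, Measure.map_apply hX measurableSet_Ici, lintegral_map (by fun_prop) hX] at hl
  have e : ∀ ω, 4 / 9 * (1 + 2 * l) * ((X ω - (M - σ / z)) / k) ^ 2 =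
      4 / 9 * (1 + 2 * l) / k ^ 2 * (X ω - (M - σ / z)) ^ 2 := fun ω => by
    field_simp
  simp only [e] at hl
  rw [lintegral_mul_sub_sq_eq hL (by positivity), ← hM,
    ← ofReal_measureReal, ← ENNReal.ofReal_add (by positivity) measureReal_nonneg,
    ENNReal.ofReal_le_ofReal_iff (mul_nonneg (by positivity)
      (add_nonneg (variance_nonneg _ _) (sq_nonneg _)))] at hl
  have hq : 4 / 9 * (1 + 2 * l) / k ^ 2 * (variance X (Q : Measure Ω) +
      (M - (M - σ / z)) ^ 2) ≤ 4 / 9 * (1 + 2 * l) * (1 + z ^ 2)⁻¹ := by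
    calc _ ≤ 4 / 9 * (1 + 2 * l) / k ^ 2 * (σ ^ 2 + (M - (M - σ / z)) ^ 2) := by gcongr
      _ = _ := by
        rw [hk]
        field_simp
        ring
  have hmono : (Q : Measure Ω) {ω | μ + σ * z ≤ X ω} ≤
      (Q : Measure Ω) (X ⁻¹' Set.Ici (M + σ * z)) :=
    measure_mono fun ω hω => by
      simp only [Set.mem_ofPred_eq, Set.mem_preimage, Set.mem_Ici] at hω ⊢
      linarith
  refine hmono.trans ?_
  rw [← ofReal_measureReal]
  refine ENNReal.ofReal_le_ofReal ?_
  set q := (1 + z ^ 2)⁻¹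
  -- The bound is the convex combination, with weights `1 - l` and `l`, of the two terms in the
  -- maximum.
  have h1 := mul_le_mul_of_nonneg_left (le_max_left (4 / 9 * q) ((4 * q - 1) / 3))
    (sub_nonneg.2 hl1)
  have h2 := mul_le_mul_of_nonneg_left (le_max_right (4 / 9 * q) ((4 * q - 1) / 3)) hl0
  linarith

theorem lintegral_baseE_le_one (hσ : 0 < σ) (hQ : Q ∈ hypMeanVar X μ σ) :
    ∫⁻ ω, ENNReal.ofReal (baseE X μ σ ω) ∂(Q : Measure Ω) ≤ 1 := by
  obtain ⟨hL, hmean, hvar⟩ := hQ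
  set M := ∫ ω, X ω ∂(Q : Measure Ω) with hM
  calc ∫⁻ ω, ENNReal.ofReal (baseE X μ σ ω) ∂(Q : Measure Ω)
      ≤ ∫⁻ ω, ENNReal.ofReal (1 / σ ^ 2 * (X ω - M) ^ 2) ∂(Q : Measure Ω) := by
        refine lintegral_mono fun ω => ENNReal.ofReal_le_ofReal ?_
        rw [baseE, one_div_mul_eq_div]
        gcongr ?_ / _
        rcases le_total (X ω - μ) 0 with h | h
        · rw [max_eq_right h, zero_pow two_ne_zero]; exact sq_nonneg _
        · rw [max_eq_left h]
          exact pow_le_pow_left₀ h (by linarith) 2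
    _ = ENNReal.ofReal (1 / σ ^ 2 * variance X (Q : Measure Ω)) := by
        rw [lintegral_mul_sub_sq_eq hL (by positivity), ← hM]
        simp
    _ ≤ 1 := by
        rw [ENNReal.ofReal_le_one, one_div_mul_eq_div, div_le_one (by positivity)]
        exact hvar

end UpperBounds

/-! ### Extremal laws -/

section Extremal

/-- The mixture of a point mass at `m`, of weight `1 - p`, and the uniform distribution on
`(a, b]`, of weight `p`. -/
noncomputable def atomUniform (p m a b : ℝ) : Measure ℝ :=
  ENNReal.ofReal (p / (b - a)) • volume.restrict (Set.Ioc a b) +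
    ENNReal.ofReal (1 - p) • Measure.dirac m

variable {p m a b : ℝ}

theorem isProbabilityMeasure_atomUniform (hp0 : 0 ≤ p) (hp1 : p ≤ 1) (hab : a < b) :
    IsProbabilityMeasure (atomUniform p m a b) := by
  have hba : 0 < b - a := sub_pos.2 hab
  refine ⟨?_⟩
  simp only [atomUniform, Measure.coe_add, Pi.add_apply, Measure.smul_apply, smul_eq_mul,
    Measure.restrict_apply_univ, Real.volume_Ioc, measure_univ, mul_one]
  rw [← ENNReal.ofReal_mul (by positivity), ← ENNReal.ofReal_add (by positivity) (by linarith),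
    div_mul_cancel₀ _ hba.ne']
  simp

theorem isUnimodal_atomUniform (h : m = a ∨ m = b) :
    IsUnimodal (atomUniform p m a b) := by
  refine ⟨m, (Set.Ioc a b).indicator fun _ => Real.toNNReal (p / (b - a)), Real.toNNReal (1 - p),
    ?_, ?_, ?_⟩
  · intro x hx y hy hxy
    simp only [Set.mem_Iio] at hx hy
    by_cases hxs : x ∈ Set.Ioc a b
    · have hys : y ∈ Set.Ioc a b := by
        rcases h with rfl | rfl
        · exact absurd hxs.1 hx.not_gt
        · exact ⟨hxs.1.trans_le hxy, hy.le⟩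
      rw [Set.indicator_of_mem hxs, Set.indicator_of_mem hys]
    · rw [Set.indicator_of_notMem hxs]; exact zero_le
  · intro x hx y hy hxy
    simp only [Set.mem_Ioi] at hx hy
    by_cases hys : y ∈ Set.Ioc a b
    · have hxs : x ∈ Set.Ioc a b := by
        rcases h with rfl | rfl
        · exact ⟨hx, hxy.trans hys.2⟩
        · exact absurd hys.2 hy.not_ge
      rw [Set.indicator_of_mem hxs, Set.indicator_of_mem hys]
    · rw [Set.indicator_of_notMem hys]; exact zero_le
  · have e : (fun x => (((Set.Ioc a b).indicator (fun _ => Real.toNNReal (p / (b - a))) x : ℝ≥0) :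
        ℝ≥0∞)) = (Set.Ioc a b).indicator fun _ => ENNReal.ofReal (p / (b - a)) := by
      ext x
      by_cases hx : x ∈ Set.Ioc a b <;> simp [hx, ENNReal.ofReal]
    rw [e, withDensity_indicator measurableSet_Ioc, withDensity_const]
    rfl

theorem integrable_atomUniform {g : ℝ → ℝ} (hg : Continuous g) :
    Integrable g (atomUniform p m a b) :=
  (hg.integrableOn_Ioc.smul_measure ENNReal.ofReal_ne_top).add_measure
    ((integrable_dirac (by simp)).smul_measure ENNReal.ofReal_ne_top)

theorem integral_atomUniform {g : ℝ → ℝ} (hg : Continuous g) (hp0 : 0 ≤ p) (hp1 : p ≤ 1)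
    (hab : a < b) :
    ∫ x, g x ∂(atomUniform p m a b) = p / (b - a) * (∫ x in a..b, g x) + (1 - p) * g m := by
  have hba : 0 < b - a := sub_pos.2 hab
  rw [atomUniform, integral_add_measure (hg.integrableOn_Ioc.smul_measure ENNReal.ofReal_ne_top)
    ((integrable_dirac (by simp)).smul_measure ENNReal.ofReal_ne_top), integral_smul_measure,
    integral_smul_measure, integral_dirac, intervalIntegral.integral_of_le hab.le,
    ENNReal.toReal_ofReal (by positivity), ENNReal.toReal_ofReal (by linarith), smul_eq_mul,
    smul_eq_mul]

theorem integral_id_atomUniform (hp0 : 0 ≤ p) (hp1 : p ≤ 1) (hab : a < b) :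
    ∫ x, x ∂(atomUniform p m a b) = p * (a + b) / 2 + (1 - p) * m := by
  have hba : b - a ≠ 0 := (sub_pos.2 hab).ne'
  rw [integral_atomUniform continuous_id' hp0 hp1 hab, integral_id]
  field_simp
  ring

theorem integral_sq_atomUniform (hp0 : 0 ≤ p) (hp1 : p ≤ 1) (hab : a < b) :
    ∫ x, x ^ 2 ∂(atomUniform p m a b) =
      p * (a ^ 2 + a * b + b ^ 2) / 3 + (1 - p) * m ^ 2 := by
  have hba : b - a ≠ 0 := (sub_pos.2 hab).ne'
  rw [integral_atomUniform (continuous_pow 2) hp0 hp1 hab, integral_pow]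
  field_simp
  norm_num
  ring

variable {Ω : Type*} [MeasurableSpace Ω] {X : Ω → ℝ} {μ σ : ℝ}

theorem exists_mem_hypUnimodal_map_eq_atomUniform (hX : Measurable X) (hlaws : CarriesAllLaws X)
    (hp0 : 0 ≤ p) (hp1 : p ≤ 1) (hab : a < b) (hm : m = a ∨ m = b)
    (hmean : p * (a + b) / 2 + (1 - p) * m = μ)
    (hsq : p * (a ^ 2 + a * b + b ^ 2) / 3 + (1 - p) * m ^ 2 = σ ^ 2 + μ ^ 2) :
    ∃ Q ∈ hypUnimodal X μ σ, (Q : Measure Ω).map X = atomUniform p m a b ∧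
      ∫ ω, X ω ∂(Q : Measure Ω) = μ ∧ variance X (Q : Measure Ω) = σ ^ 2 := by
  obtain ⟨Q, hQ⟩ := hlaws ⟨_, isProbabilityMeasure_atomUniform (m := m) hp0 hp1 hab⟩
  change (Q : Measure Ω).map X = atomUniform p m a b at hQ
  have hL : MemLp X 2 (Q : Measure Ω) := by
    rw [memLp_two_iff_integrable_sq hX.aestronglyMeasurable]
    have := integrable_atomUniform (p := p) (m := m) (a := a) (b := b) (continuous_pow 2)
    rw [← hQ] at this
    exact this.comp_measurable hX
  have h1 : ∫ ω, X ω ∂(Q : Measure Ω) = μ := by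
    rw [← hmean, ← integral_id_atomUniform hp0 hp1 hab, ← hQ,
      integral_map hX.aemeasurable (by fun_prop)]
  have h2 : ∫ ω, X ω ^ 2 ∂(Q : Measure Ω) = σ ^ 2 + μ ^ 2 := by
    rw [← hsq, ← integral_sq_atomUniform hp0 hp1 hab, ← hQ,
      integral_map hX.aemeasurable (by fun_prop)]
  have h3 : variance X (Q : Measure Ω) = σ ^ 2 := by
    rw [variance_eq_sub hL, h1]
    simp only [Pi.pow_apply]
    rw [h2]; ring
  refine ⟨Q, ⟨⟨hL, h1.le, h3.le⟩, ?_⟩, hQ, h1, h3⟩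
  rw [hQ]
  exact isUnimodal_atomUniform hm

/-- The extremal law for large thresholds: its mode is the left endpoint of its support. -/
theorem exists_extremal_left_mode (hX : Measurable X) (hlaws : CarriesAllLaws X) (hσ : 0 < σ)
    {z : ℝ} (hz : 0 < z) (hz' : 1 / 3 ≤ z ^ 2) :
    ∃ Q ∈ hypUnimodal X μ σ,
      ENNReal.ofReal (4 / 9 * (1 + z ^ 2)⁻¹) ≤ (Q : Measure Ω) {ω | μ + σ * z ≤ X ω} ∧
      (∀ᵐ ω ∂(Q : Measure Ω), μ - σ / z ≤ X ω) ∧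
      ∫ ω, X ω ∂(Q : Measure Ω) = μ ∧ variance X (Q : Measure Ω) = σ ^ 2 := by
  set c := μ - σ / z with hc
  set k := σ * (z + 1 / z) with hk
  have hk0 : 0 < k := by positivity
  -- This weight on `(c, c + 3k/2]` gives mean `μ` and variance `σ²`; a third of it lies beyond `c +
  -- k`. It is at most `1` exactly when `z² ≥ 1/3`.
  set p := 4 / 3 * (1 + z ^ 2)⁻¹ with hp
  have hp0 : 0 ≤ p := by positivity
  have hp1 : p ≤ 1 := by
    rw [hp, ← div_eq_mul_inv, div_le_one (by positivity)]; linarith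
  obtain ⟨Q, hQ, hmap, h1, h2⟩ := exists_mem_hypUnimodal_map_eq_atomUniform (μ := μ) (σ := σ)
    (p := p) (m := c) (a := c) (b := c + 3 / 2 * k) hX hlaws hp0 hp1 (by linarith) (.inl rfl)
    (by rw [hp, hc, hk]; field_simp; ring) (by rw [hp, hc, hk]; field_simp; ring)
  refine ⟨Q, hQ, ?_, ?_, h1, h2⟩
  · have hset : {ω | μ + σ * z ≤ X ω} = X ⁻¹' Set.Ici (c + k) := by
      ext ω
      simp only [Set.mem_ofPred_eq, Set.mem_preimage, Set.mem_Ici]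
      rw [show c + k = μ + σ * z by rw [hc, hk]; ring]
    rw [hset, ← Measure.map_apply hX measurableSet_Ici, hmap]
    calc ENNReal.ofReal (4 / 9 * (1 + z ^ 2)⁻¹)
        = ENNReal.ofReal (p / (c + 3 / 2 * k - c)) *
            volume (Set.Ioc (c + k) (c + 3 / 2 * k)) := by
          rw [Real.volume_Ioc, ← ENNReal.ofReal_mul (div_nonneg hp0 (by linarith))]
          congr 1
          rw [show (1 + z ^ 2)⁻¹ = 3 / 4 * p by rw [hp]; ring]
          field_simp
          ring
      _ ≤ ENNReal.ofReal (p / (c + 3 / 2 * k - c)) *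
            volume.restrict (Set.Ioc c (c + 3 / 2 * k)) (Set.Ici (c + k)) := by
          rw [Measure.restrict_apply measurableSet_Ici]
          gcongr
          exact fun x hx => ⟨hx.1.le, by linarith [hx.1], hx.2⟩
      _ ≤ _ := by
          simp only [atomUniform, Measure.coe_add, Pi.add_apply, Measure.smul_apply, smul_eq_mul]
          exact le_self_add
  · have : ∀ᵐ x ∂((Q : Measure Ω).map X), c ≤ x := by
      rw [hmap, ae_iff]
      have hset : {x : ℝ | ¬c ≤ x} = Set.Iio c := by ext x; simp
      have hempty : Set.Iio c ∩ Set.Ioc c (c + 3 / 2 * k) = ∅ := by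
        ext x
        simp only [Set.mem_inter_iff, Set.mem_Iio, Set.mem_Ioc, Set.mem_empty_iff_false, iff_false]
        rintro ⟨h1, h2, -⟩
        exact lt_asymm h1 h2
      rw [hset]
      simp [atomUniform, Measure.restrict_apply measurableSet_Iio, hempty]
    exact ae_of_ae_map hX.aemeasurable this

/-- The extremal law for small thresholds: its mode is the right endpoint of its support. -/
theorem exists_extremal_right_mode (hX : Measurable X) (hlaws : CarriesAllLaws X) (hσ : 0 < σ)
    {z : ℝ} (hz : 0 < z) (hz' : z ^ 2 ≤ 3) :
    ∃ Q ∈ hypUnimodal X μ σ,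
      ENNReal.ofReal ((4 * (1 + z ^ 2)⁻¹ - 1) / 3) ≤
        (Q : Measure Ω) {ω | μ + σ * z ≤ X ω} := by
  set c := μ - σ / z with hc
  set k := σ * (z + 1 / z) with hk
  have hk0 : 0 < k := by positivity
  -- The weight on `(c - k/2, c + k]` matching both moments; the atom of weight `1 - p` sits exactly
  -- on the threshold.
  set p := 4 / 3 * (z ^ 2 / (1 + z ^ 2)) with hp
  have hp0 : 0 ≤ p := by positivity
  have hp1 : p ≤ 1 := by
    rw [hp, ← mul_div_assoc, div_le_one (by positivity)]; linarith
  obtain ⟨Q, hQ, hmap, -, -⟩ := exists_mem_hypUnimodal_map_eq_atomUniform (μ := μ) (σ := σ)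
    (p := p) (m := c + k) (a := c - k / 2) (b := c + k) hX hlaws hp0 hp1 (by linarith) (.inr rfl)
    (by rw [hp, hc, hk]; field_simp; ring) (by rw [hp, hc, hk]; field_simp; ring)
  refine ⟨Q, hQ, ?_⟩
  have hset : {ω | μ + σ * z ≤ X ω} = X ⁻¹' Set.Ici (c + k) := by
    ext ω
    simp only [Set.mem_ofPred_eq, Set.mem_preimage, Set.mem_Ici]
    rw [show c + k = μ + σ * z by rw [hc, hk]; ring]
  rw [hset, ← Measure.map_apply hX measurableSet_Ici, hmap,
    show (4 * (1 + z ^ 2)⁻¹ - 1) / 3 = 1 - p by rw [hp]; field_simp; ring]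
  simp [atomUniform]

end Extremal

/-! ### From tail thresholds to p-values, and sharpness of the e-value -/

section Transform

theorem max_mul_le_max_mul_iff {p q : ℝ} :
    max (4 / 9 * p) ((4 * p - 1) / 3) ≤ max (4 / 9 * q) ((4 * q - 1) / 3) ↔ p ≤ q := by
  have hmono : StrictMono fun p : ℝ => max (4 / 9 * p) ((4 * p - 1) / 3) :=
    fun x y h => max_lt_max (by linarith) (by linarith)
  exact hmono.le_iff_le

theorem exists_threshold {α : ℝ} (hα : α ∈ Set.Ioo (0 : ℝ) 1) :
    ∃ z : ℝ, 0 < z ∧ max (4 / 9 * (1 + z ^ 2)⁻¹) ((4 * (1 + z ^ 2)⁻¹ - 1) / 3) = α := by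
  suffices h : ∃ q : ℝ, 0 < q ∧ q < 1 ∧ max (4 / 9 * q) ((4 * q - 1) / 3) = α by
    obtain ⟨q, hq0, hq1, hq⟩ := h
    have h1 : 0 < q⁻¹ - 1 := sub_pos.2 ((one_lt_inv₀ hq0).2 hq1)
    refine ⟨Real.sqrt (q⁻¹ - 1), Real.sqrt_pos.2 h1, ?_⟩
    rw [Real.sq_sqrt h1.le, add_sub_cancel, inv_inv, hq]
  obtain ⟨h0, h1⟩ := hα
  -- The two branches of the maximum cross at `q = 3/8`, with common value `1/6`.
  rcases le_total α (1 / 6) with h | h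
  · exact ⟨9 * α / 4, by linarith, by linarith, by rw [max_eq_left (by linarith)]; ring⟩
  · exact ⟨(3 * α + 1) / 4, by linarith, by linarith, by rw [max_eq_right (by linarith)]; ring⟩

theorem baseP_le_inv_iff {Ω : Type*} {X : Ω → ℝ} {μ σ : ℝ} (hσ : 0 < σ) {z : ℝ} (hz : 0 < z) (ω : Ω) :
    baseP X μ σ ω ≤ (1 + z ^ 2)⁻¹ ↔ μ + σ * z ≤ X ω := by
  rw [baseP, inv_le_inv₀ (by positivity) (by positivity), add_le_add_iff_left, ← div_pow,
    pow_le_pow_iff_left₀ hz.le (div_nonneg (le_max_right _ _) hσ.le) two_ne_zero,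
    le_div_iff₀ hσ, le_max_iff]
  have : 0 < z * σ := by positivity
  constructor
  · rintro (h | h) <;> linarith
  · intro h; left; linarith

variable {Ω : Type*} [MeasurableSpace Ω] {X : Ω → ℝ} {μ σ : ℝ}

/-- Under the left-mode law `(X - μ)²/σ²` has mean `1`, and `X ≥ μ - σ/z` almost surely, so
truncating at `μ` loses at most `1/z²`. -/
theorem exists_mem_hypUnimodal_lintegral_baseE (hX : Measurable X) (hlaws : CarriesAllLaws X)
    (hσ : 0 < σ) {ε : ℝ} (hε : 0 < ε) :
    ∃ Q ∈ hypUnimodal X μ σ,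
      1 ≤ (∫⁻ ω, ENNReal.ofReal (baseE X μ σ ω) ∂(Q : Measure Ω)) + ENNReal.ofReal ε := by
  set z := 1 + 1 / ε with hz
  have hz0 : 0 < z := by positivity
  have hz1 : 1 ≤ z := by rw [hz]; linarith [show 0 < 1 / ε by positivity]
  have hzε : 1 / z ^ 2 ≤ ε := by
    rw [div_le_iff₀ (by positivity)]
    have : 1 ≤ ε * z := by rw [hz]; field_simp; linarith
    nlinarith
  obtain ⟨Q, hQ, -, hae, hmean, hvar⟩ :=
    exists_extremal_left_mode (μ := μ) hX hlaws hσ hz0 (by nlinarith)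
  refine ⟨Q, hQ, ?_⟩
  calc (1 : ℝ≥0∞) = ∫⁻ ω, ENNReal.ofReal (1 / σ ^ 2 * (X ω - μ) ^ 2) ∂(Q : Measure Ω) := by
        rw [lintegral_mul_sub_sq_eq hQ.1.1 (by positivity), hmean, hvar]
        rw [sub_self, zero_pow two_ne_zero, add_zero, one_div_mul_cancel (by positivity),
          ENNReal.ofReal_one]
    _ ≤ ∫⁻ ω, (ENNReal.ofReal (baseE X μ σ ω) + ENNReal.ofReal ε) ∂(Q : Measure Ω) := by
        refine lintegral_mono_ae ?_
        filter_upwards [hae] with ω hω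
        rw [← ENNReal.ofReal_add (by rw [baseE]; positivity) hε.le]
        refine ENNReal.ofReal_le_ofReal ?_
        rw [baseE, one_div_mul_eq_div]
        rcases le_total 0 (X ω - μ) with h | h
        · rw [max_eq_left h]; linarith
        · rw [max_eq_right h]
          have h1 : (X ω - μ) ^ 2 ≤ (σ / z) ^ 2 :=
            sq_le_sq' (by linarith) (h.trans (by positivity))
          calc (X ω - μ) ^ 2 / σ ^ 2 ≤ (σ / z) ^ 2 / σ ^ 2 := by gcongr
            _ = 1 / z ^ 2 := by field_simp
            _ ≤ _ := by simpa using hzε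
    _ = _ := by
        rw [lintegral_add_right _ measurable_const]
        simp

end Transform

/-! ### The theorem -/

theorem theorem3 {Ω : Type*} [MeasurableSpace Ω] (X : Ω → ℝ) (hX : Measurable X)
    (hlaws : CarriesAllLaws X) (μ σ : ℝ) (hσ : 0 < σ) :
    IsPrecisePVariable (hypUnimodal X μ σ)
        (fun ω => max (4 / 9 * baseP X μ σ ω) ((4 * baseP X μ σ ω - 1) / 3)) ∧
      IsPreciseEVariable (hypUnimodal X μ σ)
        (fun ω => ENNReal.ofReal (baseE X μ σ ω)) := by
  have hset : ∀ z : ℝ, 0 < z → {ω | max (4 / 9 * baseP X μ σ ω) ((4 * baseP X μ σ ω - 1) / 3) ≤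
      max (4 / 9 * (1 + z ^ 2)⁻¹) ((4 * (1 + z ^ 2)⁻¹ - 1) / 3)} = {ω | μ + σ * z ≤ X ω} := by
    intro z hz
    ext ω
    rw [Set.mem_ofPred_eq, max_mul_le_max_mul_iff, baseP_le_inv_iff hσ hz, Set.mem_ofPred_eq]
  have hup : ∀ Q ∈ hypUnimodal X μ σ, ∀ α ∈ Set.Ioo (0 : ℝ) 1, (Q : Measure Ω)
      {ω | max (4 / 9 * baseP X μ σ ω) ((4 * baseP X μ σ ω - 1) / 3) ≤ α} ≤
        ENNReal.ofReal α := by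
    intro Q hQ α hα
    obtain ⟨z, hz, rfl⟩ := exists_threshold hα
    rw [hset z hz]
    exact measure_tail_le_of_mem_hypUnimodal hX hσ hQ hz
  have hupE : ∀ Q ∈ hypUnimodal X μ σ,
      ∫⁻ ω, ENNReal.ofReal (baseE X μ σ ω) ∂(Q : Measure Ω) ≤ 1 := fun Q hQ =>
    lintegral_baseE_le_one hσ hQ.1
  have hmP : Measurable (baseP X μ σ) := by unfold baseP; fun_prop
  have hmE : Measurable (baseE X μ σ) := by unfold baseE; fun_prop
  refine ⟨⟨⟨by fun_prop, hup⟩, fun α hα => le_antisymm (iSup₂_le fun Q hQ => hup Q hQ α hα) ?_⟩,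
    ⟨by fun_prop, hupE⟩, le_antisymm (iSup₂_le hupE) ?_⟩
  · obtain ⟨z, hz, rfl⟩ := exists_threshold hα
    rw [hset z hz]
    -- `z² = 5/3` is the crossing `q = 3/8`; it lies within `[1/3, 3]`, so on each side the law
    -- attaining the larger branch exists.
    rcases le_total (5 / 3) (z ^ 2) with h | h
    · have hq : (1 + z ^ 2)⁻¹ ≤ 3 / 8 := by
        rw [inv_le_comm₀ (by positivity) (by norm_num)]; linarith
      obtain ⟨Q, hQ, hle, -⟩ :=
        exists_extremal_left_mode (μ := μ) hX hlaws hσ hz (by linarith)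
      rw [max_eq_left (by linarith)]
      exact hle.trans (le_iSup₂ (f := fun (Q : ProbabilityMeasure Ω) (_ : Q ∈ hypUnimodal X μ σ) =>
        (Q : Measure Ω) {ω | μ + σ * z ≤ X ω}) Q hQ)
    · have hq : 3 / 8 ≤ (1 + z ^ 2)⁻¹ := by
        rw [le_inv_comm₀ (by norm_num) (by positivity)]; linarith
      obtain ⟨Q, hQ, hle⟩ :=
        exists_extremal_right_mode (μ := μ) hX hlaws hσ hz (by linarith)
      rw [max_eq_right (by linarith)]
      exact hle.trans (le_iSup₂ (f := fun (Q : ProbabilityMeasure Ω) (_ : Q ∈ hypUnimodal X μ σ) =>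
        (Q : Measure Ω) {ω | μ + σ * z ≤ X ω}) Q hQ)
  · refine ENNReal.le_of_forall_pos_le_add fun ε hε _ => ?_
    obtain ⟨Q, hQ, hle⟩ := exists_mem_hypUnimodal_lintegral_baseE (μ := μ) hX hlaws hσ
      (NNReal.coe_pos.2 hε)
    rw [ENNReal.ofReal_coe_nnreal] at hle
    refine hle.trans ?_
    gcongr
    exact le_iSup₂ (f := fun (Q : ProbabilityMeasure Ω) (_ : Q ∈ hypUnimodal X μ σ) =>
      ∫⁻ ω, ENNReal.ofReal (baseE X μ σ ω) ∂(Q : Measure Ω)) Q hQ
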